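/- Let $k,N,p_0\ge 1$, $m=k+N$. Let $\{(x_t,u_t)\}_{t\in\mathbb Z}$ be a process on a probability space with $x_t$ $\mathbb R^k$-valued and $u_t$ $\mathbb R^N$-valued, square-integrable, $\mathbb E[x_t]=\mu_x$ and $\mathbb E[u_t]=0$ for all $t$. Put $\bar z_t=((x_t-\mu_x)',u_t')'$. Let $\mathscr H_t$ be the $L^2$-closure of the set of finite sums $\sum_{s\le t}A_s\bar z_s$ with $A_s\in\mathbb R^{m\times m}$, let $\mathscr P_{t-1}$ be the orthogonal projection of $L^2(\Omega;\mathbb R^m)$ onto $\mathscr H_{t-1}$, let $\mathscr P^{(p_0)}_{t-1}$ be the orthogonal projection onto $\{\sum_{j=1}^{p_0}A_j\bar z_{t-j}: A_j\in\mathbb R^{m\times m}\}$, and let $\varepsilon_t=(\varepsilon_{x,t}',\varepsilon_{u,t}')'=\bar z_t-\mathscr P_{t-1}[\bar z_t]$. Assumption 1 (with lag order $p_0$): (A1.1) $\{\bar z_t\}$ is covariance-stationary, $\bigcap_t\mathscr H_t=\{0\}$, and $\mathscr P_{t-1}[\bar z_t]=\mathscr P^{(p_0)}_{t-1}[\bar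 z_t]$ for all $t$. (A1.2) For some $\delta>0$, $\{\varepsilon_t\}$ is strongly mixing with mixing coefficients satisfying $\sum_{\ell\ge1}\alpha_\varepsilon(\ell)^{\delta/(2+\delta)}<\infty$, and $\mathbb E\|\varepsilon_t\|^{4+2\delta}<\infty$ for all $t$; moreover $\Sigma=\mathbb E[\varepsilon_t\varepsilon_t']$ is positive definite. Here $\alpha_\varepsilon(\ell)$ is the supremum of $|\mathbb P(A\cap B)-\mathbb P(A)\mathbb P(B)|$ over all $t$, $A\in\sigma(\varepsilon_s:s\le t-\ell)$ and $B\in\sigma(\varepsilon_s:s\ge t)$. Partition $\Sigma$ and $m\times m$ matrices $\Psi_j$ into blocks $xx,xu,ux,uu$ according to $m=k+N$. Consider the conditions: - strict exogeneity: $\mathbb E[u_tx_s']=0$ for all $t,s$; - present-and-past exogeneity: $\mathbb E[u_tx_s']=0$ for all $t$ and all $s\le t$; - pre-determined: $\mathbb E[x_t\varepsilon_{u,t+h}']=0$ for all $t$ and all $h\ge0$; - BD: $\bar z_t=\sum_{j=1}^{p_0}\Psi_j\bar z_{t-j}+\varepsilon_t$ for all $t$ with all $\Psi_j$ block-diagonal,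 and $\Sigma$ is block-diagonal; - EBD: $\bar z_t=\sum_{j=1}^{p_0}\Psi_j\bar z_{t-j}+\varepsilon_t$ for all $t$ with unrestricted $\Psi_j$, and $\Sigma$ is block-diagonal. Proposition 2. Under Assumption 1: (i) Strict exogeneity is equivalent to BD. (ii) The pre-determined condition is equivalent to EBD, and EBD is equivalent to $\Sigma_{xu}=0$. (iii) For all $k,N,p_0\ge1$, within the class of processes satisfying Assumption 1 with lag order $p_0$, $\mathrm{BD}\subsetneq\{\text{present-and-past exogeneity}\}\cap\mathrm{EBD}\subsetneq\mathrm{EBD}$. Moreover, scalar VAR(1) processes ($k=N=p_0=1$) separate the classes: for every $\gamma\ne0$ there is a process satisfying Assumption 1, with $\Psi_1=\begin{pmatrix}0&\gamma\\0&0\end{pmatrix}$, that satisfies EBD and present-and-past exogeneity but not BD; and for all $\rho_x,\rho_u,\alpha$ with $|\rho_x|<1$, $|\rho_u|<1$, $\rho_u\neq0$, $\alpha\ne0$ there is a process satisfying Assumption 1, with $\Psi_1=\begin{pmatrix}\rho_x&\alpha\\0&\rho_u\end{pmatrix}$, that satisfies EBD but not present-and-past exogeneity. -/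

import Mathlib

open MeasureTheory ProbabilityTheory Filter Topology

universe u

/-- A data-generating process for a `k`-dimensional regressor process `x` and an `N`-dimensional
disturbance process `u`, both indexed by `ℤ`, on some probability space: all coordinates are
square-integrable, `E[x t] = μx` for all `t`, and `E[u t] = 0` for all `t`. -/
structure DGP (k N : ℕ) : Type (u + 1) where
  /-- the sample space -/
  Ω : Type u
  /-- its σ-algebra -/
  mΩ : MeasurableSpace Ω
  /-- the probability measure -/
  P : Measure Ω
  isProb : IsProbabilityMeasure P
  /-- regressors: time, coordinate, sample point -/
  x : ℤ → Fin k → Ω → ℝ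
  /-- disturbances: time, coordinate, sample point -/
  u : ℤ → Fin N → Ω → ℝ
  /-- mean of the regressors -/
  μx : Fin k → ℝ
  memLp_x : ∀ t i, MemLp (x t i) 2 P
  memLp_u : ∀ t i, MemLp (u t i) 2 P
  mean_x : ∀ t i, ∫ ω, x t i ω ∂P = μx i
  mean_u : ∀ t i, ∫ ω, u t i ω ∂P = 0

attribute [instance] DGP.mΩ DGP.isProb

namespace DGP

noncomputable section

variable {k N : ℕ} (D : DGP.{u} k N)

/-- The centered stacked process `z̄ t = ((x t - μx)', (u t)')'`, coordinate by coordinate. -/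
def zc (t : ℤ) : Fin k ⊕ Fin N → D.Ω → ℝ
  | Sum.inl i => fun ω => D.x t i ω - D.μx i
  | Sum.inr i => D.u t i

theorem memLp_zc (t : ℤ) (i : Fin k ⊕ Fin N) : MemLp (D.zc t i) 2 D.P := by
  cases i with
  | inl i => exact (D.memLp_x t i).sub (memLp_const (D.μx i))
  | inr i => exact D.memLp_u t i

/-- The coordinates of `z̄ t` as elements of the Hilbert space `L²(Ω, P)`. -/
def zbar (t : ℤ) (i : Fin k ⊕ Fin N) : Lp ℝ 2 D.P := (D.memLp_zc t i).toLp (D.zc t i)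

/-- `H t`: the closed linear span in `L²` of all coordinates of `z̄ t, z̄ (t-1), …`.
A random vector all of whose coordinates lie in `H t` is an `L²`-limit of finite sums
`∑ A_s z̄ s`, `s ≤ t`, with matrix coefficients `A_s`. -/
def past (t : ℤ) : Submodule ℝ (Lp ℝ 2 D.P) :=
  (Submodule.span ℝ {v | ∃ s : ℤ, s ≤ t ∧ ∃ i, v = D.zbar s i}).topologicalClosure

/-- The linear span of all coordinates of `z̄ (t-1), …, z̄ (t-p)`. -/
def finitePast (p : ℕ) (t : ℤ) : Submodule ℝ (Lp ℝ 2 D.P) :=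
  Submodule.span ℝ
    (Set.range fun q : Fin p × (Fin k ⊕ Fin N) => D.zbar (t - ((q.1 : ℤ) + 1)) q.2)

instance (t : ℤ) : CompleteSpace (D.past t) := by
  unfold past
  infer_instance

instance (p : ℕ) (t : ℤ) : FiniteDimensional ℝ (D.finitePast p t) :=
  FiniteDimensional.span_of_finite ℝ (Set.finite_range _)

/-- The one-step-ahead innovation `ε t = z̄ t - P_{t-1}[z̄ t]`, where `P_{t-1}` is the orthogonal
projection onto `H (t-1)`. -/
def innov (t : ℤ) (i : Fin k ⊕ Fin N) : Lp ℝ 2 D.P :=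
  D.zbar t i - (D.past (t - 1)).starProjection (D.zbar t i)

/-- The innovation covariance matrix `Σ = E[ε t (ε t)']` (at time `t`). -/
def innovCov (t : ℤ) : Matrix (Fin k ⊕ Fin N) (Fin k ⊕ Fin N) ℝ :=
  Matrix.of fun i j => ∫ ω, D.innov t i ω * D.innov t j ω ∂D.P

/-- The σ-algebra generated by the innovations up to time `t`. -/
abbrev sigmaPast (t : ℤ) : MeasurableSpace D.Ω :=
  ⨆ (s : ℤ) (_ : s ≤ t) (i : Fin k ⊕ Fin N),
    MeasurableSpace.comap (fun ω => D.innov s i ω) (inferInstance : MeasurableSpace ℝ)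

/-- The σ-algebra generated by the innovations from time `t` onwards. -/
abbrev sigmaFuture (t : ℤ) : MeasurableSpace D.Ω :=
  ⨆ (s : ℤ) (_ : t ≤ s) (i : Fin k ⊕ Fin N),
    MeasurableSpace.comap (fun ω => D.innov s i ω) (inferInstance : MeasurableSpace ℝ)

/-- The strong (`α`-)mixing coefficients of the innovation sequence: the supremum of
`|P(A ∩ B) - P(A) P(B)|` over all times `t`, all `A` in the σ-algebra of the innovations up to
`t - ℓ` and all `B` in the σ-algebra of the innovations from `t` onwards. -/
def alphaMix (ℓ : ℕ) : ℝ :=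
  sSup {r | ∃ (t : ℤ) (A B : Set D.Ω), MeasurableSet[D.sigmaPast (t - ℓ)] A ∧
    MeasurableSet[D.sigmaFuture t] B ∧ r = |D.P.real (A ∩ B) - D.P.real A * D.P.real B|}

/-- The standing assumption, with lag order `p`. -/
structure FinitePredictorExact (p : ℕ) : Prop where
  one_le : 1 ≤ p
  /-- the process is covariance-stationary -/
  stationary : ∀ (t h : ℤ) (i j : Fin k ⊕ Fin N),
    cov[D.zc (t + h) i, D.zc t j; D.P] = cov[D.zc h i, D.zc 0 j; D.P]
  /-- the process is purely nondeterministic -/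
  nondeterministic : ⨅ t : ℤ, D.past t = ⊥
  /-- prediction from the whole past equals prediction from the last `p` observations -/
  exact_predictor : ∀ (t : ℤ) (i : Fin k ⊕ Fin N),
    (D.past (t - 1)).starProjection (D.zbar t i) =
      (D.finitePast p t).starProjection (D.zbar t i)
  /-- the innovations are strongly mixing at a summable rate and have finite moments -/
  mixing_moments : ∃ δ : ℝ, 0 < δ ∧
    Tendsto D.alphaMix atTop (𝓝 0) ∧
    Summable (fun ℓ : ℕ => D.alphaMix (ℓ + 1) ^ (δ / (2 + δ))) ∧
    ∀ t : ℤ, MemLp (fun ω => WithLp.toLp 2 (fun i => D.innov t i ω))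
      (ENNReal.ofReal (4 + 2 * δ)) D.P
  /-- the innovation covariance matrix is positive definite -/
  posDef : ∀ t : ℤ, (D.innovCov t).PosDef

/-- `z̄ t = ∑_{j=1}^{p} Ψ_j z̄ (t-j) + ε t` in `L²` for all `t` (`Ψ j` is the coefficient of lag
`j + 1`). -/
def IsVAR (p : ℕ) (Ψ : Fin p → Matrix (Fin k ⊕ Fin N) (Fin k ⊕ Fin N) ℝ) : Prop :=
  ∀ (t : ℤ) (i : Fin k ⊕ Fin N),
    D.zbar t i = (∑ j : Fin p, ∑ l, Ψ j i l • D.zbar (t - ((j : ℤ) + 1)) l) + D.innov t i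

/-- `Σ_xu = 0`. -/
def SigmaXUZero : Prop := ∀ t : ℤ, (D.innovCov t).toBlocks₁₂ = 0

/-- Covariance-based strict exogeneity: `E[u_t x_s'] = 0` for all `t, s`. -/
def StrictlyExogenous : Prop :=
  ∀ (t s : ℤ) (i : Fin N) (j : Fin k), ∫ ω, D.u t i ω * D.x s j ω ∂D.P = 0

/-- Covariance-based present-and-past exogeneity: `E[u_t x_s'] = 0` for all `s ≤ t`. -/
def PresentPastExogenous : Prop :=
  ∀ (t s : ℤ), s ≤ t → ∀ (i : Fin N) (j : Fin k), ∫ ω, D.u t i ω * D.x s j ω ∂D.P = 0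

/-- The regressors are pre-determined: `E[x_t (ε_{u,t}, ε_{u,t+1}, …)'] = 0` for all `t`. -/
def PreDetermined : Prop :=
  ∀ (t : ℤ) (h : ℕ) (j : Fin k) (i : Fin N),
    ∫ ω, D.x t j ω * D.innov (t + h) (Sum.inr i) ω ∂D.P = 0

/-- The block-diagonal condition: VAR(`p`) with block-diagonal coefficients and block-diagonal
innovation covariance. -/
def BD (p : ℕ) : Prop :=
  (∃ Ψ : Fin p → Matrix (Fin k ⊕ Fin N) (Fin k ⊕ Fin N) ℝ, D.IsVAR p Ψ ∧
    ∀ j, (Ψ j).toBlocks₁₂ = 0 ∧ (Ψ j).toBlocks₂₁ = 0) ∧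
  ∀ t : ℤ, (D.innovCov t).toBlocks₁₂ = 0 ∧ (D.innovCov t).toBlocks₂₁ = 0

/-- The error-block-diagonal condition: VAR(`p`) with unrestricted coefficients and
block-diagonal innovation covariance. -/
def EBD (p : ℕ) : Prop :=
  (∃ Ψ : Fin p → Matrix (Fin k ⊕ Fin N) (Fin k ⊕ Fin N) ℝ, D.IsVAR p Ψ) ∧
  ∀ t : ℤ, (D.innovCov t).toBlocks₁₂ = 0 ∧ (D.innovCov t).toBlocks₂₁ = 0

end

/-- The class of data-generating processes that satisfy the standing assumption and BD. -/
def classBD (k N p : ℕ) : Set (DGP.{u} k N) := {D | D.FinitePredictorExact p ∧ D.BD p}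

/-- The class of data-generating processes that satisfy the standing assumption and EBD. -/
def classEBD (k N p : ℕ) : Set (DGP.{u} k N) := {D | D.FinitePredictorExact p ∧ D.EBD p}

/-- The class of data-generating processes that satisfy the standing assumption and
present-and-past exogeneity. -/
def classPP (k N p : ℕ) : Set (DGP.{u} k N) :=
  {D | D.FinitePredictorExact p ∧ D.PresentPastExogenous}

end DGP

/-! Everything is Hilbert space geometry in `L²`, where covariances are inner products and `ε_t` is
the component of `z̄_t` orthogonal to the past.

Pre-determinedness: `x_t` and `ε_{x,t}` differ by an element of the past, to which `ε_{u,t}` is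
orthogonal, so `E[x_t ε_{u,t}'] = Σ_xu`, and positive leads vanish automatically. A VAR
representation always exists: exact prediction gives coefficients at time 0, and stationarity
carries them to every time (`exists_isVAR`). Hence EBD says no more than `Σ_xu = 0`.

Strict exogeneity gives BD: in the equation of one block, the contribution of the lags of the other
block is orthogonal to every other term, hence to itself, so it is zero. Conversely, under BD each
block is predicted from its own past with the joint innovations as its own. A dual Wold argument
(`inner_eq_zero_of_inner_innovation_eq_zero`) then turns orthogonality of the innovations into
orthogonality of the processes.

The strict inclusions come from one family of examples: a triangular VAR(1), driven by independent
fair signs, in which lagged `u` feeds `x`. If `u` is white noise, it is uncorrelated with present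
and past `x` but not with the next `x`. If `u` is autocorrelated, it is correlated with present or
past `x`. Such a VAR(1) satisfies the standing assumption with every lag order `p ≥ 1`. -/

/-! ### Closed pasts in a Hilbert space and the dual Wold decomposition. -/

section ClosedPast

variable {ι E : Type*} [NormedAddCommGroup E] [InnerProductSpace ℝ E]

/-- The closed linear span of the values up to time `t` of a family of vector processes. -/
def closedPast (z : ℤ → ι → E) (t : ℤ) : Submodule ℝ E :=
  (Submodule.span ℝ {v | ∃ s : ℤ, s ≤ t ∧ ∃ i, v = z s i}).topologicalClosure

theorem mem_closedPast (z : ℤ → ι → E) {s t : ℤ} (h : s ≤ t) (i : ι) :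
    z s i ∈ closedPast z t :=
  Submodule.le_topologicalClosure _ (Submodule.subset_span ⟨s, h, i, rfl⟩)

theorem closedPast_mono (z : ℤ → ι → E) {s t : ℤ} (h : s ≤ t) :
    closedPast z s ≤ closedPast z t := by
  refine Submodule.topologicalClosure_mono (Submodule.span_mono ?_)
  rintro v ⟨r, hr, i, rfl⟩
  exact ⟨r, hr.trans h, i, rfl⟩

theorem closedPast_le_comp {κ : Type*} (z : ℤ → ι → E) (f : κ → ι) (t : ℤ) :
    closedPast (fun s a => z s (f a)) t ≤ closedPast z t := by
  refine Submodule.topologicalClosure_mono (Submodule.span_mono ?_)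
  rintro v ⟨r, hr, i, rfl⟩
  exact ⟨r, hr, f i, rfl⟩

theorem inner_eq_zero_of_mem_closedPast {z : ℤ → ι → E} {t : ℤ} {w v : E}
    (h : ∀ s ≤ t, ∀ i, inner ℝ w (z s i) = 0) (hv : v ∈ closedPast z t) :
    inner ℝ w v = 0 := by
  have hle : closedPast z t ≤ (ℝ ∙ w)ᗮ := by
    refine Submodule.topologicalClosure_minimal _ (Submodule.span_le.2 ?_)
      (Submodule.isClosed_orthogonal _)
    rintro v ⟨s, hs, i, rfl⟩
    exact Submodule.mem_orthogonal_singleton_iff_inner_right.2 (h s hs i)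
  exact Submodule.mem_orthogonal_singleton_iff_inner_right.1 (hle hv)

/-- The Wold decomposition in dual form: a vector orthogonal to all innovations of a purely
nondeterministic process is orthogonal to the process. -/
theorem inner_eq_zero_of_inner_innovation_eq_zero [CompleteSpace E] {z e : ℤ → ι → E}
    (hmem : ∀ t i, z t i - e t i ∈ closedPast z (t - 1))
    (horth : ∀ t i, ∀ v ∈ closedPast z (t - 1), inner ℝ (e t i) v = 0)
    (hbot : ⨅ t : ℤ, closedPast z t = ⊥) {w : E} (hw : ∀ t i, inner ℝ w (e t i) = 0)
    (t : ℤ) (i : ι) : inner ℝ w (z t i) = 0 := by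
  have hcomp : ∀ t, CompleteSpace (closedPast z t) := fun t => by
    unfold closedPast; infer_instance
  set W : ℤ → E := fun n => (closedPast z n).starProjection w with hW
  have hWmem : ∀ n, W n ∈ closedPast z n := fun n => Submodule.starProjection_apply_mem _ _
  have hWorth : ∀ n, ∀ v ∈ closedPast z n, inner ℝ (W n) v = inner ℝ w v := by
    intro n v hv
    have := Submodule.starProjection_inner_eq_zero (K := closedPast z n) w v hv
    rw [inner_sub_left] at this
    linarith
  have hemem : ∀ n i, e n i ∈ closedPast z n := by
    intro n i
    have h1 := (closedPast z n).sub_mem (mem_closedPast z le_rfl i)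
      (closedPast_mono z (by lia) (hmem n i))
    simpa using h1
  -- The increment of the projections lies in the past of `n` and is orthogonal both to the past of
  -- `n - 1` and to `e n`. These generate the past of `n`, so it is orthogonal to itself.
  have hstep : ∀ n, W n = W (n - 1) := by
    intro n
    set r := W n - W (n - 1) with hr
    have hrmem : r ∈ closedPast z n :=
      (closedPast z n).sub_mem (hWmem n) (closedPast_mono z (by lia) (hWmem _))
    have hr1 : ∀ v ∈ closedPast z (n - 1), inner ℝ r v = 0 := by
      intro v hv
      rw [hr, inner_sub_left, hWorth n v (closedPast_mono z (by lia) hv), hWorth _ v hv, sub_self]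
    have hr2 : ∀ i, inner ℝ r (e n i) = 0 := by
      intro i
      rw [hr, inner_sub_left, hWorth n _ (hemem n i), hw, real_inner_comm,
        horth n i _ (hWmem _), sub_zero]
    have hrr : inner ℝ r r = 0 := by
      refine inner_eq_zero_of_mem_closedPast (fun s hs i => ?_) hrmem
      rcases hs.lt_or_eq with hlt | rfl
      · exact hr1 _ (mem_closedPast z (by lia) i)
      · have := hr1 _ (hmem s i)
        rw [inner_sub_right, hr2, sub_zero] at this
        exact this
    exact sub_eq_zero.1 (inner_self_eq_zero.1 hrr)
  have hconst : ∀ n : ℕ, W t = W (t - n) := by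
    intro n
    induction n with
    | zero => simp
    | succ n ih => rw [ih, hstep]; congr 1; push_cast; ring
  -- Being constant in time, the projection lies in the remote past, which is trivial.
  have hzero : W t = 0 := by
    rw [← Submodule.mem_bot ℝ, ← hbot, Submodule.mem_iInf]
    intro s
    rcases le_total t s with h | h
    · exact closedPast_mono z h (hWmem t)
    · have := hconst (t - s).toNat
      rw [this]
      convert hWmem s using 2
      have := Int.toNat_of_nonneg (sub_nonneg.2 h)
      lia
  rw [← hWorth t _ (mem_closedPast z le_rfl i), hzero, inner_zero_left]

end ClosedPast

/-! ### Innovations as `L²` vectors, and pre-determinedness. -/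

namespace DGP

variable {k N : ℕ} (D : DGP.{u} k N)

theorem inner_Lp_eq_integral {Ω : Type*} {m : MeasurableSpace Ω} {P : Measure Ω}
    (f g : Lp ℝ 2 P) : inner ℝ f g = ∫ ω, f ω * g ω ∂P := by
  rw [L2.inner_def]
  refine integral_congr_ae (ae_of_all _ fun ω => ?_)
  simp [mul_comm]

theorem zbar_ae (t : ℤ) (i : Fin k ⊕ Fin N) : D.zbar t i =ᵐ[D.P] D.zc t i :=
  MemLp.coeFn_toLp _

theorem inner_zbar (s t : ℤ) (i j : Fin k ⊕ Fin N) :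
    inner ℝ (D.zbar s i) (D.zbar t j) = ∫ ω, D.zc s i ω * D.zc t j ω ∂D.P := by
  rw [inner_Lp_eq_integral]
  refine integral_congr_ae ?_
  filter_upwards [D.zbar_ae s i, D.zbar_ae t j] with ω h1 h2
  rw [h1, h2]

theorem integral_zc (t : ℤ) (i : Fin k ⊕ Fin N) : ∫ ω, D.zc t i ω ∂D.P = 0 := by
  cases i with
  | inl i =>
    simp only [zc]
    rw [integral_sub ((D.memLp_x t i).integrable one_le_two) (integrable_const _), D.mean_x]
    simp
  | inr i => exact D.mean_u t i

theorem covariance_zc (s t : ℤ) (i j : Fin k ⊕ Fin N) :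
    cov[D.zc s i, D.zc t j; D.P] = ∫ ω, D.zc s i ω * D.zc t j ω ∂D.P := by
  simp only [covariance, integral_zc, sub_zero]

theorem inner_zbar_inr_inl (t s : ℤ) (i : Fin N) (j : Fin k) :
    inner ℝ (D.zbar t (Sum.inr i)) (D.zbar s (Sum.inl j)) = ∫ ω, D.u t i ω * D.x s j ω ∂D.P := by
  rw [inner_zbar]
  simp only [zc, mul_sub]
  have h1 : Integrable (fun ω => D.u t i ω * D.x s j ω) D.P :=
    (D.memLp_u t i).integrable_mul (D.memLp_x s j)
  rw [integral_sub h1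
    (((D.memLp_u t i).integrable one_le_two).mul_const _), integral_mul_const, D.mean_u]
  simp

theorem innovCov_apply (t : ℤ) (i j : Fin k ⊕ Fin N) :
    D.innovCov t i j = inner ℝ (D.innov t i) (D.innov t j) := by
  rw [inner_Lp_eq_integral]; rfl

theorem zbar_sub_innov_mem (t : ℤ) (i : Fin k ⊕ Fin N) :
    D.zbar t i - D.innov t i ∈ D.past (t - 1) := by
  simp only [innov, sub_sub_cancel]
  exact Submodule.starProjection_apply_mem _ _

theorem inner_innov (t : ℤ) (i : Fin k ⊕ Fin N) {v : Lp ℝ 2 D.P} (hv : v ∈ D.past (t - 1)) :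
    inner ℝ (D.innov t i) v = 0 :=
  Submodule.starProjection_inner_eq_zero _ _ hv

theorem innov_mem (t : ℤ) (i : Fin k ⊕ Fin N) : D.innov t i ∈ D.past t := by
  -- `D.past t` and `closedPast D.zbar t` agree definitionally, so the Hilbert space lemmas apply
  -- directly.
  have h1 := (D.past t).sub_mem (mem_closedPast D.zbar le_rfl i)
    (closedPast_mono D.zbar (by lia) (D.zbar_sub_innov_mem t i))
  simpa using h1

theorem inner_innov_innov {s t : ℤ} (h : s ≠ t) (i j : Fin k ⊕ Fin N) :
    inner ℝ (D.innov s i) (D.innov t j) = 0 := by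
  rcases h.lt_or_gt with h | h
  · rw [real_inner_comm]
    exact D.inner_innov _ _ (closedPast_mono D.zbar (by lia) (D.innov_mem s i))
  · exact D.inner_innov _ _ (closedPast_mono D.zbar (by lia) (D.innov_mem t j))

/-- Expectation is the inner product with the constant 1. That constant is orthogonal to every
centered coordinate, hence to the closed span containing the innovation. -/
theorem integral_innov (t : ℤ) (i : Fin k ⊕ Fin N) : ∫ ω, D.innov t i ω ∂D.P = 0 := by
  have h1 : ∀ f : Lp ℝ 2 D.P,
      inner ℝ ((memLp_const (1 : ℝ)).toLp (fun _ => (1 : ℝ)) : Lp ℝ 2 D.P) f =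
        ∫ ω, f ω ∂D.P := by
    intro f
    rw [inner_Lp_eq_integral]
    refine integral_congr_ae ?_
    filter_upwards [(memLp_const (1 : ℝ) : MemLp _ 2 D.P).coeFn_toLp] with ω h
    rw [h, one_mul]
  rw [← h1]
  refine inner_eq_zero_of_mem_closedPast (fun s _ j => ?_) (D.innov_mem t i)
  rw [h1, integral_congr_ae (D.zbar_ae s j), D.integral_zc]

/-- Centering `x` is immaterial here because innovations have mean zero. -/
theorem integral_x_mul_innov (s t : ℤ) (j : Fin k) (i : Fin k ⊕ Fin N) :
    ∫ ω, D.x s j ω * D.innov t i ω ∂D.P =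
      inner ℝ (D.zbar s (Sum.inl j)) (D.innov t i) := by
  have h1 : ∫ ω, (D.x s j ω - D.μx j) * D.innov t i ω ∂D.P =
      inner ℝ (D.zbar s (Sum.inl j)) (D.innov t i) := by
    rw [inner_Lp_eq_integral]
    refine integral_congr_ae ?_
    filter_upwards [D.zbar_ae s (Sum.inl j)] with ω h
    rw [h]; rfl
  rw [← h1]
  simp only [sub_mul]
  have h2 : Integrable (fun ω => D.x s j ω * D.innov t i ω) D.P :=
    (D.memLp_x s j).integrable_mul (Lp.memLp _)
  rw [integral_sub h2
    (((Lp.memLp (D.innov t i)).integrable one_le_two).const_mul _), integral_const_mul,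
    D.integral_innov]
  simp

theorem toBlocks₂₁_innovCov (t : ℤ) :
    (D.innovCov t).toBlocks₂₁ = (D.innovCov t).toBlocks₁₂.transpose := by
  ext i j
  simp only [Matrix.toBlocks₂₁, Matrix.toBlocks₁₂, Matrix.of_apply, Matrix.transpose_apply,
    innovCov_apply]
  exact real_inner_comm _ _

theorem preDetermined_iff_sigmaXUZero : D.PreDetermined ↔ D.SigmaXUZero := by
  have h0 : ∀ t j i, inner ℝ (D.zbar t (Sum.inl j)) (D.innov t (Sum.inr i)) =
      (D.innovCov t).toBlocks₁₂ j i := by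
    intro t j i
    have h := D.inner_innov t (Sum.inr i) (D.zbar_sub_innov_mem t (Sum.inl j))
    rw [real_inner_comm, inner_sub_left, sub_eq_zero] at h
    rw [h]
    exact (D.innovCov_apply t _ _).symm
  constructor
  · intro h t
    ext j i
    have := h t 0 j i
    rw [integral_x_mul_innov] at this
    rw [← h0]
    simpa using this
  · intro h t n j i
    rw [integral_x_mul_innov]
    rcases Nat.eq_zero_or_pos n with rfl | hn
    · simp only [Nat.cast_zero, add_zero]
      rw [h0, h t, Matrix.zero_apply]
    · rw [real_inner_comm]
      exact D.inner_innov _ _ (mem_closedPast D.zbar (by lia) _)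

/-! ### VAR representation, and the equivalences with EBD and BD. -/

variable {D} {p : ℕ}

theorem zbar_mem_finitePast (t : ℤ) (a : Fin p) (l : Fin k ⊕ Fin N) :
    D.zbar (t - ((a : ℤ) + 1)) l ∈ D.finitePast p t :=
  Submodule.subset_span ⟨(a, l), rfl⟩

theorem finitePast_le_past (t : ℤ) : D.finitePast p t ≤ D.past (t - 1) := by
  refine Submodule.span_le.2 ?_
  rintro v ⟨⟨a, l⟩, rfl⟩
  exact mem_closedPast D.zbar (by have := a.val.zero_le; lia) l

theorem FinitePredictorExact.inner_zbar_add (hD : D.FinitePredictorExact p) (t r s : ℤ)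
    (i j : Fin k ⊕ Fin N) : inner ℝ (D.zbar (t + r) i) (D.zbar (t + s) j) =
      inner ℝ (D.zbar r i) (D.zbar s j) := by
  have hcov : ∀ s t i j, inner ℝ (D.zbar s i) (D.zbar t j) = cov[D.zc s i, D.zc t j; D.P] := by
    intro s t i j
    rw [inner_zbar, covariance_zc]
  rw [hcov, hcov, show t + r = (t + s) + (r - s) by ring, hD.stationary]
  rw [← hD.stationary s (r - s)]
  simp

/-- Exact finite prediction of a stationary process gives a VAR representation. -/
theorem FinitePredictorExact.exists_isVAR (hD : D.FinitePredictorExact p) :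
    ∃ Ψ : Fin p → Matrix (Fin k ⊕ Fin N) (Fin k ⊕ Fin N) ℝ, D.IsVAR p Ψ := by
  have hex : ∀ i, ∃ c : Fin p × (Fin k ⊕ Fin N) → ℝ,
      ∑ q, c q • D.zbar (0 - ((q.1 : ℤ) + 1)) q.2 =
        (D.finitePast p 0).starProjection (D.zbar 0 i) := fun i => by
    have h := Submodule.starProjection_apply_mem (D.finitePast p 0) (D.zbar 0 i)
    exact (Submodule.mem_span_range_iff_exists_fun ℝ).1 h
  choose c hc using hex
  refine ⟨fun a => Matrix.of fun i l => c i (a, l), fun t i => ?_⟩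
  have hsum : ∀ t, (∑ a : Fin p, ∑ l, c i (a, l) • D.zbar (t - ((a : ℤ) + 1)) l) =
      ∑ q : Fin p × (Fin k ⊕ Fin N), c i q • D.zbar (t - ((q.1 : ℤ) + 1)) q.2 := fun t =>
    (Fintype.sum_prod_type
      (fun q : Fin p × (Fin k ⊕ Fin N) => c i q • D.zbar (t - ((q.1 : ℤ) + 1)) q.2)).symm
  -- The coefficients found at time 0 solve the normal equations at time `t` too, since these
  -- involve only inner products, which are invariant under a time shift.
  have hproj : (D.finitePast p t).starProjection (D.zbar t i) =
      ∑ q : Fin p × (Fin k ⊕ Fin N), c i q • D.zbar (t - ((q.1 : ℤ) + 1)) q.2 := by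
    refine Submodule.eq_starProjection_of_mem_orthogonal
      (Submodule.sum_mem _ fun q _ => Submodule.smul_mem _ _ (zbar_mem_finitePast _ _ _)) ?_
    have h0 := Submodule.sub_starProjection_mem_orthogonal (K := D.finitePast p 0) (D.zbar 0 i)
    rw [← hc] at h0
    rw [finitePast, Submodule.mem_orthogonal']
    intro v hv
    induction hv using Submodule.span_induction with
    | zero => simp
    | add x y _ _ hx hy => rw [inner_add_right, hx, hy, add_zero]
    | smul a x _ hx => rw [inner_smul_right, hx, mul_zero]
    | mem x hx =>
      obtain ⟨q, rfl⟩ := hx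
      have h1 := (Submodule.mem_orthogonal' _ _).1 h0 _
        (zbar_mem_finitePast (D := D) 0 q.1 q.2)
      simp only [inner_sub_left, sum_inner, inner_smul_left] at h1 ⊢
      rw [← h1]
      have e0 : ∀ m j j', inner ℝ (D.zbar (t - m) j) (D.zbar (t - ((q.1 : ℤ) + 1)) j') =
          inner ℝ (D.zbar (0 - m) j) (D.zbar (0 - ((q.1 : ℤ) + 1)) j') := fun m j j' => by
        have := hD.inner_zbar_add t (0 - m) (0 - ((q.1 : ℤ) + 1)) j j'
        convert this using 3 <;> ring
      have e1 := e0 0 i q.2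
      simp only [sub_zero] at e1
      simp only [e0, e1]
  simp only [Matrix.of_apply]
  rw [hsum, ← hproj, ← hD.exact_predictor]
  simp [innov]

theorem FinitePredictorExact.ebd_iff_sigmaXUZero (hD : D.FinitePredictorExact p) :
    D.EBD p ↔ D.SigmaXUZero :=
  ⟨fun h t => (h.2 t).1, fun h => ⟨hD.exists_isVAR, fun t =>
    ⟨h t, by rw [toBlocks₂₁_innovCov, h t, Matrix.transpose_zero]⟩⟩⟩

theorem BD.ebd (h : D.BD p) : D.EBD p :=
  ⟨⟨h.1.choose, h.1.choose_spec.1⟩, h.2⟩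

/-- The off-diagonal coefficients are not shown to vanish. Only their total contribution `w` is, by
pairing the VAR equation with `w`, and this allows them to be replaced by zero. -/
theorem FinitePredictorExact.bd_of_strictlyExogenous (hD : D.FinitePredictorExact p)
    (h : D.StrictlyExogenous) : D.BD p := by
  have hux : ∀ s t i j, inner ℝ (D.zbar s (Sum.inr i)) (D.zbar t (Sum.inl j)) = 0 :=
    fun s t i j => by rw [inner_zbar_inr_inl, h]
  have hxu : ∀ s t i j, inner ℝ (D.zbar s (Sum.inl i)) (D.zbar t (Sum.inr j)) = 0 :=
    fun s t i j => by rw [real_inner_comm, hux]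
  obtain ⟨Ψ, hΨ⟩ := hD.exists_isVAR
  have hinn : ∀ t i (a : Fin p) l, inner ℝ (D.innov t i) (D.zbar (t - ((a : ℤ) + 1)) l) = 0 :=
    fun t i a l => D.inner_innov _ _ (mem_closedPast D.zbar (by have := a.val.zero_le; lia) l)
  have hoff₁ : ∀ t i, (∑ a : Fin p, ∑ l : Fin N,
      Ψ a (Sum.inl i) (Sum.inr l) • D.zbar (t - ((a : ℤ) + 1)) (Sum.inr l)) = 0 := by
    intro t i
    set w := ∑ a : Fin p, ∑ l : Fin N,
      Ψ a (Sum.inl i) (Sum.inr l) • D.zbar (t - ((a : ℤ) + 1)) (Sum.inr l) with hw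
    have hVAR := hΨ t (Sum.inl i)
    simp only [Fintype.sum_sum_type, Finset.sum_add_distrib] at hVAR
    rw [← hw] at hVAR
    have h1 : inner ℝ (D.zbar t (Sum.inl i)) w = 0 := by simp [hw, inner_sum, inner_smul_right, hxu]
    have h2 : inner ℝ (D.innov t (Sum.inl i)) w = 0 := by
      simp [hw, inner_sum, inner_smul_right, hinn]
    have h3 : inner ℝ (∑ a : Fin p, ∑ l : Fin k,
      Ψ a (Sum.inl i) (Sum.inl l) • D.zbar (t - ((a : ℤ) + 1)) (Sum.inl l)) w = 0 := by
      simp [hw, inner_sum, sum_inner, inner_smul_left, inner_smul_right, hxu]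
    rw [hVAR, inner_add_left, inner_add_left, h2, h3] at h1
    simpa using h1
  have hoff₂ : ∀ t i, (∑ a : Fin p, ∑ l : Fin k,
      Ψ a (Sum.inr i) (Sum.inl l) • D.zbar (t - ((a : ℤ) + 1)) (Sum.inl l)) = 0 := by
    intro t i
    set w := ∑ a : Fin p, ∑ l : Fin k,
      Ψ a (Sum.inr i) (Sum.inl l) • D.zbar (t - ((a : ℤ) + 1)) (Sum.inl l) with hw
    have hVAR := hΨ t (Sum.inr i)
    simp only [Fintype.sum_sum_type, Finset.sum_add_distrib] at hVAR
    rw [← hw] at hVAR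
    have h1 : inner ℝ (D.zbar t (Sum.inr i)) w = 0 := by simp [hw, inner_sum, inner_smul_right, hux]
    have h2 : inner ℝ (D.innov t (Sum.inr i)) w = 0 := by
      simp [hw, inner_sum, inner_smul_right, hinn]
    have h3 : inner ℝ (∑ a : Fin p, ∑ l : Fin N,
      Ψ a (Sum.inr i) (Sum.inr l) • D.zbar (t - ((a : ℤ) + 1)) (Sum.inr l)) w = 0 := by
      simp [hw, inner_sum, sum_inner, inner_smul_left, inner_smul_right, hux]
    rw [hVAR, inner_add_left, inner_add_left, h2, h3] at h1
    simpa using h1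
  have hx : ∀ t i, D.zbar t (Sum.inl i) = (∑ a : Fin p, ∑ l : Fin k,
      Ψ a (Sum.inl i) (Sum.inl l) • D.zbar (t - ((a : ℤ) + 1)) (Sum.inl l)) +
      D.innov t (Sum.inl i) := by
    intro t i
    have hVAR := hΨ t (Sum.inl i)
    simpa only [Fintype.sum_sum_type, Finset.sum_add_distrib, hoff₁, add_zero] using hVAR
  have hu : ∀ t i, D.zbar t (Sum.inr i) = (∑ a : Fin p, ∑ l : Fin N,
      Ψ a (Sum.inr i) (Sum.inr l) • D.zbar (t - ((a : ℤ) + 1)) (Sum.inr l)) +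
      D.innov t (Sum.inr i) := by
    intro t i
    have hVAR := hΨ t (Sum.inr i)
    simpa only [Fintype.sum_sum_type, Finset.sum_add_distrib, hoff₂, zero_add] using hVAR
  refine ⟨⟨fun a => Matrix.fromBlocks (Ψ a).toBlocks₁₁ 0 0 (Ψ a).toBlocks₂₂, ?_, fun a => by simp⟩,
    (hD.ebd_iff_sigmaXUZero.2 fun t => ?_).2⟩
  · rintro t (i | i)
    · simpa [Matrix.toBlocks₁₁] using hx t i
    · simpa [Matrix.toBlocks₂₂] using hu t i
  · ext i j
    change D.innovCov t _ _ = 0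
    -- Each innovation is now a combination of its own block, so `Σ_xu` expands into cross-block
    -- inner products only.
    rw [innovCov_apply, ← sub_eq_iff_eq_add'.2 (hx t i), ← sub_eq_iff_eq_add'.2 (hu t j)]
    simp [inner_sub_left, inner_sub_right, inner_sum, sum_inner, inner_smul_left,
      inner_smul_right, hxu]

theorem FinitePredictorExact.strictlyExogenous_of_bd (hD : D.FinitePredictorExact p)
    (h : D.BD p) : D.StrictlyExogenous := by
  obtain ⟨⟨Ψ, hΨ, hblock⟩, hS⟩ := h
  have h12 : ∀ a i l, Ψ a (Sum.inl i) (Sum.inr l) = 0 := fun a i l =>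
    congr_fun (congr_fun (hblock a).1 i) l
  have h21 : ∀ a i l, Ψ a (Sum.inr i) (Sum.inl l) = 0 := fun a i l =>
    congr_fun (congr_fun (hblock a).2 i) l
  -- A block inherits a trivial remote past from the joint process, which lets the Wold argument run
  -- on each block separately.
  have hbot : ∀ {κ : Type} (f : κ → Fin k ⊕ Fin N),
      ⨅ t : ℤ, closedPast (fun s b => D.zbar s (f b)) t = ⊥ := fun f =>
    le_bot_iff.1 ((iInf_mono fun t => closedPast_le_comp D.zbar f t).trans hD.nondeterministic.le)
  have hmemx : ∀ t i, D.zbar t (Sum.inl i) - D.innov t (Sum.inl i) ∈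
      closedPast (fun s b => D.zbar s (Sum.inl b)) (t - 1) := by
    intro t i
    rw [hΨ t (Sum.inl i), add_sub_cancel_right]
    simp only [Fintype.sum_sum_type, h12, zero_smul, Finset.sum_const_zero, add_zero]
    exact Submodule.sum_mem _ fun a _ => Submodule.sum_mem _ fun l _ => Submodule.smul_mem _ _
      (mem_closedPast (fun s b => D.zbar s (Sum.inl b)) (by have := a.val.zero_le; lia) l)
  have hmemu : ∀ t i, D.zbar t (Sum.inr i) - D.innov t (Sum.inr i) ∈
      closedPast (fun s b => D.zbar s (Sum.inr b)) (t - 1) := by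
    intro t i
    rw [hΨ t (Sum.inr i), add_sub_cancel_right]
    simp only [Fintype.sum_sum_type, h21, zero_smul, Finset.sum_const_zero, zero_add]
    exact Submodule.sum_mem _ fun a _ => Submodule.sum_mem _ fun l _ => Submodule.smul_mem _ _
      (mem_closedPast (fun s b => D.zbar s (Sum.inr b)) (by have := a.val.zero_le; lia) l)
  have hee : ∀ s t i j, inner ℝ (D.innov s (Sum.inr i)) (D.innov t (Sum.inl j)) = 0 := by
    intro s t i j
    rcases eq_or_ne s t with rfl | hst
    · rw [← innovCov_apply]
      exact congr_fun (congr_fun (hS s).2 i) j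
    · exact D.inner_innov_innov hst _ _
  -- The Wold argument is used twice: here on the `x` block with a `u` innovation as test vector,
  -- and below on the `u` block with a coordinate of `x` as test vector.
  have hex : ∀ s t i j, inner ℝ (D.innov s (Sum.inr i)) (D.zbar t (Sum.inl j)) = 0 :=
    fun s t i j => inner_eq_zero_of_inner_innovation_eq_zero
      (z := fun s b => D.zbar s (Sum.inl b)) (e := fun s b => D.innov s (Sum.inl b)) hmemx
      (fun t i v hv => D.inner_innov t _ (closedPast_le_comp D.zbar _ _ hv)) (hbot Sum.inl)
      (fun t j => hee s t i j) t j
  intro t s i j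
  rw [← inner_zbar_inr_inl, real_inner_comm]
  exact inner_eq_zero_of_inner_innovation_eq_zero
      (z := fun s b => D.zbar s (Sum.inr b)) (e := fun s b => D.innov s (Sum.inr b)) hmemu
      (fun t i v hv => D.inner_innov t _ (closedPast_le_comp D.zbar _ _ hv)) (hbot Sum.inr)
      (fun t i => by rw [real_inner_comm]; exact hex t s i j) t i

theorem FinitePredictorExact.strictlyExogenous_iff_bd (hD : D.FinitePredictorExact p) :
    D.StrictlyExogenous ↔ D.BD p :=
  ⟨hD.bd_of_strictlyExogenous, hD.strictlyExogenous_of_bd⟩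

/-! ### Independent innovations have vanishing mixing coefficients. -/

theorem measurable_innov (D : DGP.{u} k N) (t : ℤ) (i : Fin k ⊕ Fin N) :
    Measurable fun ω => D.innov t i ω :=
  (Lp.stronglyMeasurable _).measurable

theorem indep_sigmaPast_sigmaFuture
    (hD : iIndepFun (fun (q : ℤ × (Fin k ⊕ Fin N)) ω => D.innov q.1 q.2 ω) D.P) {s t : ℤ}
    (h : s < t) : Indep (D.sigmaPast s) (D.sigmaFuture t) D.P := by
  let m : ℤ × (Fin k ⊕ Fin N) → MeasurableSpace D.Ω := fun q =>
    MeasurableSpace.comap (fun ω => D.innov q.1 q.2 ω) inferInstance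
  have hdisj : Disjoint {q : ℤ × (Fin k ⊕ Fin N) | q.1 ≤ s} {q | t ≤ q.1} :=
    Set.disjoint_left.2 fun q (h1 : q.1 ≤ s) (h2 : t ≤ q.1) => (h1.trans_lt h).not_ge h2
  have hind := indep_iSup_of_disjoint (m := m)
    (fun q => (D.measurable_innov q.1 q.2).comap_le) hD.iIndep hdisj
  have hpast : D.sigmaPast s ≤ ⨆ q ∈ {q : ℤ × (Fin k ⊕ Fin N) | q.1 ≤ s}, m q :=
    iSup₂_le fun r hr => iSup_le fun i => le_iSup₂ (f := fun q _ => m q) (r, i) hr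
  have hfuture : D.sigmaFuture t ≤ ⨆ q ∈ {q : ℤ × (Fin k ⊕ Fin N) | t ≤ q.1}, m q :=
    iSup₂_le fun r hr => iSup_le fun i => le_iSup₂ (f := fun q _ => m q) (r, i) hr
  exact indep_of_indep_of_le_left (indep_of_indep_of_le_right hind hfuture) hpast

/-- At a positive lag, past and future are generated by disjoint sets of independent variables. At
lag 0 both contain the innovations of time `t`, whence `0 < n`. -/
theorem alphaMix_eq_zero
    (hD : iIndepFun (fun (q : ℤ × (Fin k ⊕ Fin N)) ω => D.innov q.1 q.2 ω) D.P) {n : ℕ}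
    (hn : 0 < n) : D.alphaMix n = 0 := by
  have h : ∀ r ∈ {r | ∃ (t : ℤ) (A B : Set D.Ω), MeasurableSet[D.sigmaPast (t - n)] A ∧
      MeasurableSet[D.sigmaFuture t] B ∧ r = |D.P.real (A ∩ B) - D.P.real A * D.P.real B|},
      r = 0 := by
    rintro r ⟨t, A, B, hA, hB, rfl⟩
    have hlt : t - n < t := by lia
    have := (Indep_iff _ _ _).1 (indep_sigmaPast_sigmaFuture hD hlt) A B hA hB
    rw [measureReal_def, this, ENNReal.toReal_mul]
    simp [measureReal_def]
  exact le_antisymm (Real.sSup_nonpos fun r hr => (h r hr).le)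
    (Real.sSup_nonneg fun r hr => (h r hr).ge)

end DGP

/-! ### Pathwise autoregressive filters of bounded inputs. -/

section Filters

/-- A bounded sequence that satisfies a contracting homogeneous recursion up to some time
vanishes up to that time. -/
theorem eq_zero_of_bounded_of_recursion {f : ℤ → ℝ} {ρ C : ℝ} {t : ℤ} (hρ : |ρ| < 1)
    (hC : ∀ s, |f s| ≤ C) (hf : ∀ s ≤ t, f s = ρ * f (s - 1)) : ∀ s ≤ t, f s = 0 := by
  -- Iterating into the past never leaves the range `s ≤ t` in which the recursion holds.
  have h1 : ∀ n : ℕ, ∀ s ≤ t, |f s| ≤ |ρ| ^ n * C := by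
    intro n
    induction n with
    | zero => intro s _; simpa using hC s
    | succ n ih =>
      intro s hs
      rw [hf s hs, abs_mul, pow_succ', mul_assoc]
      exact mul_le_mul_of_nonneg_left (ih (s - 1) (by lia)) (abs_nonneg ρ)
  intro s hs
  have h2 : Tendsto (fun n : ℕ => |ρ| ^ n * C) atTop (𝓝 (0 * C)) :=
    (tendsto_pow_atTop_nhds_zero_of_lt_one (abs_nonneg ρ) hρ).mul_const C
  rw [zero_mul] at h2
  exact abs_nonpos_iff.1 (ge_of_tendsto' h2 fun n => h1 n s hs)

/-- The stationary solution of `y t = ρ * y (t - 1) + e t`. -/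
noncomputable def arFilter (ρ : ℝ) (e : ℤ → ℝ) (t : ℤ) : ℝ := ∑' j : ℕ, ρ ^ j * e (t - j)

variable {ρ M : ℝ} {e : ℤ → ℝ}

/-- With bounded input the series converges at every sample point, so the recursions below hold
pointwise and need no `L²` limits. -/
theorem summable_arFilter (hρ : |ρ| < 1) (he : ∀ s, |e s| ≤ M) (t : ℤ) :
    Summable fun j : ℕ => ρ ^ j * e (t - j) := by
  refine Summable.of_norm_bounded
    ((summable_geometric_of_lt_one (abs_nonneg ρ) hρ).mul_right M) fun j => ?_
  rw [norm_mul, norm_pow, Real.norm_eq_abs, Real.norm_eq_abs]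
  exact mul_le_mul_of_nonneg_left (he _) (pow_nonneg (abs_nonneg ρ) j)

theorem arFilter_eq (hρ : |ρ| < 1) (he : ∀ s, |e s| ≤ M) (t : ℤ) :
    arFilter ρ e t = ρ * arFilter ρ e (t - 1) + e t := by
  rw [arFilter, (summable_arFilter hρ he t).tsum_eq_zero_add, arFilter, ← tsum_mul_left, add_comm]
  congr 1
  · refine tsum_congr fun j => ?_
    rw [pow_succ', mul_assoc]
    congr 3
    push_cast
    ring
  · simp

theorem abs_arFilter_le (hρ : |ρ| < 1) (he : ∀ s, |e s| ≤ M) (t : ℤ) :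
    |arFilter ρ e t| ≤ (1 - |ρ|)⁻¹ * M := by
  rw [← Real.norm_eq_abs, arFilter]
  refine tsum_of_norm_bounded ((hasSum_geometric_of_lt_one (abs_nonneg ρ) hρ).mul_right M)
    fun j => ?_
  rw [norm_mul, norm_pow, Real.norm_eq_abs, Real.norm_eq_abs]
  exact mul_le_mul_of_nonneg_left (he _) (pow_nonneg (abs_nonneg ρ) j)

theorem arFilter_shift (ρ : ℝ) (e : ℤ → ℝ) (h t : ℤ) :
    arFilter ρ (fun s => e (s + h)) t = arFilter ρ e (t + h) := by
  refine tsum_congr fun j => ?_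
  simp only [sub_add_eq_add_sub]

theorem measurable_arFilter {Ω : Type*} [MeasurableSpace Ω] {f : ℤ → Ω → ℝ} (hρ : |ρ| < 1)
    (hf : ∀ s ω, |f s ω| ≤ M) (hmeas : ∀ s, Measurable (f s)) (t : ℤ) :
    Measurable fun ω => arFilter ρ (fun s => f s ω) t := by
  refine measurable_of_tendsto_metrizable
    (f := fun n : ℕ => fun ω => ∑ j ∈ Finset.range n, ρ ^ j * f (t - j) ω)
    (fun n => Finset.measurable_sum _ fun j _ => (hmeas _).const_mul _) ?_
  rw [tendsto_pi_nhds]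
  exact fun ω => (summable_arFilter hρ (fun s => hf s ω) t).hasSum.tendsto_sum_nat

end Filters

/-! ### Independent fair signs, lifted to the universe of `DGP.{u}`. -/

section Noise

/-- The law of a fair coin. -/
noncomputable def coin : Measure (ULift.{u} Bool) :=
  (2⁻¹ : ENNReal) • (Measure.dirac ⟨true⟩ + Measure.dirac ⟨false⟩)

instance : IsProbabilityMeasure coin.{u} := ⟨by
  simp [coin, ENNReal.inv_two_add_inv_two]⟩

/-- The value `±1` of a coin. -/
def coinSign (b : ULift.{u} Bool) : ℝ := if b.down then 1 else -1

theorem measurable_coinSign : Measurable coinSign.{u} :=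
  (measurable_of_finite (fun b : Bool => if b then (1 : ℝ) else -1)).comp measurable_down

theorem integral_coinSign : ∫ b, coinSign.{u} b ∂coin = 0 := by
  have hint : ∀ a : ULift.{u} Bool, Integrable coinSign (Measure.dirac a) := fun a =>
    Integrable.of_bound measurable_coinSign.aestronglyMeasurable 1 (ae_of_all _ fun b => by
      unfold coinSign; split_ifs <;> simp)
  rw [coin, integral_smul_measure, integral_add_measure (hint _) (hint _),
    integral_dirac' _ _ measurable_coinSign.stronglyMeasurable,
    integral_dirac' _ _ measurable_coinSign.stronglyMeasurable]
  simp [coinSign]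

/-- The law of a family of independent fair coins. -/
noncomputable abbrev coins (ι : Type) : Measure (ι → ULift.{u} Bool) :=
  Measure.infinitePi fun _ => coin

variable {ι : Type}

/-- The independent signs. -/
def noise (q : ι) (ω : ι → ULift.{u} Bool) : ℝ := coinSign (ω q)

theorem noise_mul_self (q : ι) (ω : ι → ULift.{u} Bool) : noise q ω * noise q ω = 1 := by
  unfold noise coinSign; split_ifs <;> norm_num

theorem abs_noise (q : ι) (ω : ι → ULift.{u} Bool) : |noise q ω| = 1 := by
  unfold noise coinSign; split_ifs <;> norm_num

theorem measurable_noise (q : ι) : Measurable (noise.{u} q) :=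
  measurable_coinSign.comp (measurable_pi_apply q)

theorem iIndepFun_noise : iIndepFun (fun q : ι => noise.{u} q) (coins ι) :=
  iIndepFun_infinitePi (X := fun _ => coinSign) fun _ => measurable_coinSign

theorem integral_noise (q : ι) : ∫ ω, noise.{u} q ω ∂(coins ι) = 0 := by
  rw [← integral_coinSign.{u},
    ← (measurePreserving_eval_infinitePi (fun _ : ι => coin.{u}) q).map_eq,
    integral_map (measurable_pi_apply q).aemeasurable measurable_coinSign.aestronglyMeasurable]
  rfl

theorem integral_noise_mul_noise [DecidableEq ι] (q r : ι) :
    ∫ ω, noise.{u} q ω * noise r ω ∂(coins ι) = if q = r then 1 else 0 := by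
  split_ifs with h
  · subst h
    simp [noise_mul_self]
  · have := (iIndepFun_noise.{u}.indepFun h).integral_fun_mul_eq_mul_integral
      (measurable_noise q).aestronglyMeasurable (measurable_noise r).aestronglyMeasurable
    rw [this, integral_noise, zero_mul]

end Noise

/-- Passes from a recursion on sample points to one between `L²` classes, whose representatives
agree with the functions only almost everywhere. -/
theorem DGP.zbar_eq_of_zc_eq {k N : ℕ} {D : DGP.{u} k N} {s t : ℤ} {i : Fin k ⊕ Fin N}
    {a : Fin k ⊕ Fin N → ℝ} {n : D.Ω → ℝ} (hn : MemLp n 2 D.P)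
    (h : ∀ ω, D.zc t i ω = (∑ l, a l * D.zc s l ω) + n ω) :
    D.zbar t i = (∑ l, a l • D.zbar s l) + hn.toLp n := by
  refine Lp.ext ?_
  have h1 : ∀ᵐ ω ∂D.P, ∀ l, D.zbar s l ω = D.zc s l ω := ae_all_iff.2 fun l => D.zbar_ae s l
  have h2 : ∀ᵐ ω ∂D.P, ∀ l, (a l • D.zbar s l : Lp ℝ 2 D.P) ω = a l * D.zbar s l ω :=
    ae_all_iff.2 fun l => Lp.coeFn_smul _ _
  filter_upwards [D.zbar_ae t i, h1, h2,
    Lp.coeFn_fun_finsetSum Finset.univ fun l => a l • D.zbar s l,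
    Lp.coeFn_add (∑ l, a l • D.zbar s l) (hn.toLp n), hn.coeFn_toLp] with ω e e1 e2 e3 e4 e5
  rw [e, e4, Pi.add_apply, e3, e5, h]
  simp only [e2, e1]

/-! ### Construction of the triangular VAR(1). -/

namespace TriangularVAR

variable {k N : ℕ}

/-- The coefficients of a triangular autoregression: `rx` and `ru` are the autoregressive
coefficients of the regressors and the disturbances, `A` is the effect of the lagged disturbances
on the regressors. -/
structure Coeffs (k N : ℕ) where
  /-- autoregressive coefficients of the regressors -/
  rx : Fin k → ℝ
  /-- autoregressive coefficients of the disturbances -/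
  ru : Fin N → ℝ
  /-- effect of the lagged disturbances on the regressors -/
  A : Matrix (Fin k) (Fin N) ℝ
  abs_rx_lt : ∀ i, |rx i| < 1
  abs_ru_lt : ∀ i, |ru i| < 1

variable (c : Coeffs k N)

/-- The sample space: one coin for each time and coordinate. -/
abbrev Sample (k N : ℕ) : Type u := ℤ × (Fin k ⊕ Fin N) → ULift.{u} Bool

/-- The law of the coins. -/
noncomputable abbrev law (k N : ℕ) : Measure (Sample.{u} k N) := coins (ℤ × (Fin k ⊕ Fin N))

/-- The disturbances. -/
noncomputable def uProc (t : ℤ) (i : Fin N) (ω : Sample.{u} k N) : ℝ :=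
  arFilter (c.ru i) (fun s => noise (s, Sum.inr i) ω) t

/-- The input of the autoregressions that define the regressors. -/
noncomputable def xInput (t : ℤ) (i : Fin k) (ω : Sample.{u} k N) : ℝ :=
  (∑ l, c.A i l * uProc c (t - 1) l ω) + noise (t, Sum.inl i) ω

/-- The regressors. -/
noncomputable def xProc (t : ℤ) (i : Fin k) (ω : Sample.{u} k N) : ℝ :=
  arFilter (c.rx i) (fun s => xInput c s i ω) t

theorem abs_uProc_le (t : ℤ) (i : Fin N) (ω : Sample.{u} k N) :
    |uProc c t i ω| ≤ (1 - |c.ru i|)⁻¹ * 1 :=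
  abs_arFilter_le (c.abs_ru_lt i) (fun _ => (abs_noise _ _).le) t

theorem abs_xInput_le (t : ℤ) (i : Fin k) (ω : Sample.{u} k N) :
    |xInput c t i ω| ≤ (∑ l, |c.A i l| * ((1 - |c.ru l|)⁻¹ * 1)) + 1 := by
  refine (abs_add_le _ _).trans (add_le_add ((Finset.abs_sum_le_sum_abs _ _).trans
    (Finset.sum_le_sum fun l _ => ?_)) (abs_noise _ _).le)
  rw [abs_mul]
  exact mul_le_mul_of_nonneg_left (abs_uProc_le c _ _ _) (abs_nonneg _)

theorem uProc_eq (t : ℤ) (i : Fin N) (ω : Sample.{u} k N) :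
    uProc c t i ω = c.ru i * uProc c (t - 1) i ω + noise (t, Sum.inr i) ω :=
  arFilter_eq (c.abs_ru_lt i) (fun _ => (abs_noise _ _).le) t

theorem xProc_eq (t : ℤ) (i : Fin k) (ω : Sample.{u} k N) :
    xProc c t i ω = c.rx i * xProc c (t - 1) i ω +
      ((∑ l, c.A i l * uProc c (t - 1) l ω) + noise (t, Sum.inl i) ω) :=
  arFilter_eq (c.abs_rx_lt i) (fun s => abs_xInput_le c s i ω) t

theorem measurable_uProc (t : ℤ) (i : Fin N) :
    Measurable fun ω : Sample.{u} k N => uProc c t i ω :=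
  measurable_arFilter (c.abs_ru_lt i) (fun _ _ => (abs_noise _ _).le)
    (fun _ => measurable_noise _) t

theorem measurable_xInput (t : ℤ) (i : Fin k) :
    Measurable fun ω : Sample.{u} k N => xInput c t i ω :=
  (Finset.measurable_sum _ fun _ _ => (measurable_uProc c _ _).const_mul _).add
    (measurable_noise _)

/-- The stacked process. -/
noncomputable def proc (t : ℤ) : Fin k ⊕ Fin N → Sample.{u} k N → ℝ
  | Sum.inl i => xProc c t i
  | Sum.inr i => uProc c t i

theorem measurable_proc (t : ℤ) (i : Fin k ⊕ Fin N) : Measurable (proc.{u} c t i) := by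
  cases i with
  | inl i =>
    exact measurable_arFilter (c.abs_rx_lt i) (fun s => abs_xInput_le c s i)
      (fun s => measurable_xInput c s i) t
  | inr i => exact measurable_uProc c t i

theorem exists_abs_proc_le (i : Fin k ⊕ Fin N) :
    ∃ C : ℝ, ∀ t ω, |proc.{u} c t i ω| ≤ C := by
  cases i with
  | inl i =>
    exact ⟨_, fun t ω => abs_arFilter_le (c.abs_rx_lt i) (fun s => abs_xInput_le c s i ω) t⟩
  | inr i => exact ⟨_, fun t ω => abs_uProc_le c t i ω⟩

theorem memLp_proc (t : ℤ) (i : Fin k ⊕ Fin N) (p : ENNReal) :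
    MemLp (proc.{u} c t i) p (law k N) := by
  obtain ⟨C, hC⟩ := exists_abs_proc_le.{u} c i
  exact MemLp.of_bound (measurable_proc c t i).aestronglyMeasurable C (ae_of_all _ fun ω => hC t ω)

theorem memLp_noise (q : ℤ × (Fin k ⊕ Fin N)) (p : ENNReal) :
    MemLp (noise.{u} q) p (law k N) :=
  MemLp.of_bound (measurable_noise q).aestronglyMeasurable 1 (ae_of_all _ fun ω =>
    (abs_noise q ω).le)

/-- Testing the recursions against an arbitrary `g` reduces all later covariance computations to
algebra. -/
theorem integral_mul_proc_inr {g : Sample.{u} k N → ℝ} (hg : MemLp g 2 (law k N)) (t : ℤ)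
    (i : Fin N) : ∫ ω, g ω * proc c t (Sum.inr i) ω ∂(law k N) =
      c.ru i * (∫ ω, g ω * proc c (t - 1) (Sum.inr i) ω ∂(law k N)) +
        ∫ ω, g ω * noise (t, Sum.inr i) ω ∂(law k N) := by
  have h1 : Integrable (fun ω => g ω * proc c (t - 1) (Sum.inr i) ω) (law k N) :=
    hg.integrable_mul (memLp_proc c _ _ 2)
  have h2 : Integrable (fun ω => g ω * noise (t, Sum.inr i) ω) (law k N) :=
    hg.integrable_mul (memLp_noise _ 2)
  rw [← integral_const_mul, ← integral_add (h1.const_mul _) h2]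
  refine integral_congr_ae (ae_of_all _ fun ω => ?_)
  simp only [proc, uProc_eq c t i ω]
  ring

theorem integral_mul_proc_inl {g : Sample.{u} k N → ℝ} (hg : MemLp g 2 (law k N)) (t : ℤ)
    (i : Fin k) : ∫ ω, g ω * proc c t (Sum.inl i) ω ∂(law k N) =
      c.rx i * (∫ ω, g ω * proc c (t - 1) (Sum.inl i) ω ∂(law k N)) +
      ((∑ l, c.A i l * ∫ ω, g ω * proc c (t - 1) (Sum.inr l) ω ∂(law k N)) +
        ∫ ω, g ω * noise (t, Sum.inl i) ω ∂(law k N)) := by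
  have h1 : ∀ l, Integrable (fun ω => g ω * proc c (t - 1) l ω) (law k N) := fun l =>
    hg.integrable_mul (memLp_proc c _ _ 2)
  have h2 : Integrable (fun ω => g ω * noise (t, Sum.inl i) ω) (law k N) :=
    hg.integrable_mul (memLp_noise _ 2)
  have h3 : ∀ l ∈ Finset.univ, Integrable
      (fun ω => c.A i l * (g ω * proc c (t - 1) (Sum.inr l) ω)) (law k N) :=
    fun l _ => (h1 _).const_mul _
  simp only [← integral_const_mul]
  have h4 : Integrable (fun ω => (∑ l, c.A i l * (g ω * proc c (t - 1) (Sum.inr l) ω)) +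
      g ω * noise (t, Sum.inl i) ω) (law k N) := (integrable_finsetSum _ h3).add h2
  rw [← integral_finsetSum _ h3, ← integral_add (integrable_finsetSum _ h3) h2,
    ← integral_add ((h1 _).const_mul _) h4]
  refine integral_congr_ae (ae_of_all _ fun ω => ?_)
  simp only [proc, xProc_eq c t i ω, mul_add, Finset.mul_sum]
  congr 1
  · ring
  · congr 1
    exact Finset.sum_congr rfl fun l _ => by ring

/-- The bound is uniform in `t`, as `eq_zero_of_bounded_of_recursion` requires. -/
theorem exists_abs_integral_mul_proc_le {g : Sample.{u} k N → ℝ} (hg : MemLp g 2 (law k N))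
    (i : Fin k ⊕ Fin N) : ∃ C : ℝ, ∀ t, |∫ ω, g ω * proc c t i ω ∂(law k N)| ≤ C := by
  obtain ⟨C, hC⟩ := exists_abs_proc_le.{u} c i
  refine ⟨∫ ω, |g ω| * C ∂(law k N), fun t => abs_integral_le_integral_abs.trans ?_⟩
  refine integral_mono ((hg.integrable_mul (memLp_proc c t i 2)).abs)
    ((hg.integrable one_le_two).abs.mul_const C) fun ω => ?_
  simp only [abs_mul]
  exact mul_le_mul_of_nonneg_left (hC t ω) (abs_nonneg _)

/-- A square-integrable variable that is uncorrelated with the noise up to time `t` is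
uncorrelated with the process up to time `t`. -/
theorem integral_mul_proc_eq_zero {g : Sample.{u} k N → ℝ} (hg : MemLp g 2 (law k N)) {t : ℤ}
    (h : ∀ s ≤ t, ∀ i, ∫ ω, g ω * noise (s, i) ω ∂(law k N) = 0) :
    ∀ s ≤ t, ∀ i, ∫ ω, g ω * proc c s i ω ∂(law k N) = 0 := by
  -- The covariances with `g` form a bounded solution of a contracting homogeneous recursion. The
  -- disturbances come first: only once their covariances vanish is the recursion for the regressors
  -- homogeneous.
  have hu : ∀ s ≤ t, ∀ i, ∫ ω, g ω * proc c s (Sum.inr i) ω ∂(law k N) = 0 := by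
    intro s hs i
    obtain ⟨C, hC⟩ := exists_abs_integral_mul_proc_le c hg (Sum.inr i)
    refine eq_zero_of_bounded_of_recursion (c.abs_ru_lt i) hC (fun s hs => ?_) s hs
    rw [integral_mul_proc_inr c hg, h s hs, add_zero]
  intro s hs i
  cases i with
  | inr i => exact hu s hs i
  | inl i =>
    obtain ⟨C, hC⟩ := exists_abs_integral_mul_proc_le c hg (Sum.inl i)
    refine eq_zero_of_bounded_of_recursion (c.abs_rx_lt i) hC (fun s hs => ?_) s hs
    rw [integral_mul_proc_inl c hg, h s hs]
    simp [hu (s - 1) (by lia)]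

theorem integral_proc (t : ℤ) (i : Fin k ⊕ Fin N) : ∫ ω, proc.{u} c t i ω ∂(law k N) = 0 := by
  have := integral_mul_proc_eq_zero c (g := fun _ => 1) (memLp_const 1) (t := t)
    (fun s _ j => by simpa using integral_noise _) t le_rfl i
  simpa using this

theorem integral_noise_mul_proc {s t : ℤ} (h : s < t) (i j : Fin k ⊕ Fin N) :
    ∫ ω, noise (t, i) ω * proc.{u} c s j ω ∂(law k N) = 0 := by
  refine integral_mul_proc_eq_zero c (memLp_noise _ 2) (t := s) (fun r hr l => ?_) s le_rfl j
  rw [integral_noise_mul_noise, if_neg]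
  intro hq
  have := congrArg Prod.fst hq
  simp only at this
  lia

/-- The time shift on the sample space. -/
def shift (h : ℤ) (ω : Sample.{u} k N) : Sample.{u} k N := fun q => ω (q.1 + h, q.2)

theorem measurePreserving_shift (h : ℤ) :
    MeasurePreserving (shift.{u} h) (law k N) (law k N) := by
  refine ⟨by unfold shift; fun_prop, ?_⟩
  have hinj : Function.Injective fun q : ℤ × (Fin k ⊕ Fin N) => (q.1 + h, q.2) := by
    rintro ⟨a, i⟩ ⟨b, j⟩ hab
    simpa using hab
  exact Measure.map_infinitePi_infinitePi_of_inj (P := fun _ => coin.{u}) hinj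

theorem uProc_shift (h t : ℤ) (i : Fin N) (ω : Sample.{u} k N) :
    uProc c t i (shift h ω) = uProc c (t + h) i ω :=
  arFilter_shift (c.ru i) (fun s => noise (s, Sum.inr i) ω) h t

theorem xInput_shift (h t : ℤ) (i : Fin k) (ω : Sample.{u} k N) :
    xInput c t i (shift h ω) = xInput c (t + h) i ω := by
  simp only [xInput, uProc_shift, show t - 1 + h = t + h - 1 by ring]
  rfl

theorem proc_shift (h t : ℤ) (i : Fin k ⊕ Fin N) (ω : Sample.{u} k N) :
    proc c t i (shift h ω) = proc c (t + h) i ω := by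
  cases i with
  | inl i =>
    simp only [proc, xProc, xInput_shift]
    exact arFilter_shift (c.rx i) (fun s => xInput c s i ω) h t
  | inr i => exact uProc_shift c h t i ω

/-- Shifting time amounts to shifting the sample point, and the product law is invariant under that
shift. -/
theorem integral_proc_mul_proc_add (h s t : ℤ) (i j : Fin k ⊕ Fin N) :
    ∫ ω, proc.{u} c (s + h) i ω * proc c (t + h) j ω ∂(law k N) =
      ∫ ω, proc.{u} c s i ω * proc c t j ω ∂(law k N) := by
  have hm := measurePreserving_shift.{u} (k := k) (N := N) h
  simp only [← proc_shift]
  rw [← integral_map (f := fun ω => proc.{u} c s i ω * proc c t j ω) hm.measurable.aemeasurable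
    ((measurable_proc c s i).mul (measurable_proc c t j)).aestronglyMeasurable, hm.map_eq]

/-- The data-generating process of the triangular autoregression. -/
noncomputable def dgp : DGP.{u} k N where
  Ω := Sample k N
  mΩ := inferInstance
  P := law k N
  isProb := inferInstance
  x := fun t i => proc c t (Sum.inl i)
  u := fun t i => proc c t (Sum.inr i)
  μx := 0
  memLp_x := fun t _ => memLp_proc c t _ 2
  memLp_u := fun t _ => memLp_proc c t _ 2
  mean_x := fun t _ => integral_proc c t _
  mean_u := fun t _ => integral_proc c t _

/-- The coefficient matrix of the stacked autoregression. -/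
def coeffMatrix : Matrix (Fin k ⊕ Fin N) (Fin k ⊕ Fin N) ℝ :=
  Matrix.fromBlocks (Matrix.diagonal c.rx) c.A 0 (Matrix.diagonal c.ru)

theorem zc_dgp (t : ℤ) (i : Fin k ⊕ Fin N) : (dgp.{u} c).zc t i = proc c t i := by
  cases i with
  | inl i => ext ω; simp [DGP.zc, dgp]
  | inr i => rfl

theorem proc_eq (t : ℤ) (i : Fin k ⊕ Fin N) (ω : Sample.{u} k N) :
    proc c t i ω = (∑ l, coeffMatrix c i l * proc c (t - 1) l ω) + noise (t, i) ω := by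
  cases i with
  | inl i =>
    simp only [proc, Fintype.sum_sum_type, coeffMatrix, Matrix.fromBlocks_apply₁₁,
      Matrix.fromBlocks_apply₁₂, Matrix.diagonal_apply, ite_mul, zero_mul,
      Finset.sum_ite_eq, Finset.mem_univ, if_true]
    rw [xProc_eq, add_assoc]
  | inr i =>
    simp only [proc, Fintype.sum_sum_type, coeffMatrix, Matrix.fromBlocks_apply₂₁,
      Matrix.fromBlocks_apply₂₂, Matrix.diagonal_apply, ite_mul, zero_mul, Matrix.zero_apply,
      Finset.sum_ite_eq, Finset.mem_univ, if_true, Finset.sum_const_zero, zero_add]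
    rw [uProc_eq]

/-- The noise as an element of `L²`. -/
noncomputable def noiseLp (t : ℤ) (i : Fin k ⊕ Fin N) : Lp ℝ 2 (dgp.{u} c).P :=
  (memLp_noise.{u} (t, i) 2).toLp (noise (t, i))

theorem noiseLp_ae (t : ℤ) (i : Fin k ⊕ Fin N) :
    noiseLp.{u} c t i =ᵐ[law k N] noise (t, i) :=
  MemLp.coeFn_toLp _

theorem zbar_dgp_eq (t : ℤ) (i : Fin k ⊕ Fin N) :
    (dgp.{u} c).zbar t i =
      (∑ l, coeffMatrix c i l • (dgp c).zbar (t - 1) l) + noiseLp c t i := by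
  refine DGP.zbar_eq_of_zc_eq (D := dgp.{u} c) (n := noise.{u} (t, i)) _ (fun ω => ?_)
  simp only [zc_dgp]
  exact proc_eq c t i ω

end TriangularVAR

/-! ### The triangular VAR(1) satisfies the standing assumption and separates the classes. -/

namespace TriangularVAR

variable {k N : ℕ} (c : Coeffs k N)

theorem inner_noiseLp (s t : ℤ) (i j : Fin k ⊕ Fin N) :
    inner ℝ (noiseLp.{u} c s i) (noiseLp c t j) = if (s, i) = (t, j) then 1 else 0 := by
  rw [← integral_noise_mul_noise.{u} (s, i) (t, j), DGP.inner_Lp_eq_integral]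
  refine integral_congr_ae ?_
  filter_upwards [noiseLp_ae c s i, noiseLp_ae c t j] with ω h1 h2
  rw [h1, h2]

theorem inner_zbar_right (v : Lp ℝ 2 (dgp.{u} c).P) (t : ℤ) (j : Fin k ⊕ Fin N) :
    inner ℝ v ((dgp.{u} c).zbar t j) = ∫ ω, v ω * proc c t j ω ∂(law k N) := by
  rw [DGP.inner_Lp_eq_integral]
  refine integral_congr_ae ?_
  filter_upwards [(dgp.{u} c).zbar_ae t j] with ω h
  rw [h, zc_dgp]

theorem inner_noiseLp_right (v : Lp ℝ 2 (dgp.{u} c).P) (t : ℤ) (j : Fin k ⊕ Fin N) :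
    inner ℝ v (noiseLp.{u} c t j) = ∫ ω, v ω * noise (t, j) ω ∂(law k N) := by
  rw [DGP.inner_Lp_eq_integral]
  refine integral_congr_ae ?_
  filter_upwards [noiseLp_ae c t j] with ω h
  rw [h]

theorem inner_noiseLp_zbar {s t : ℤ} (h : s < t) (i j : Fin k ⊕ Fin N) :
    inner ℝ (noiseLp.{u} c t i) ((dgp.{u} c).zbar s j) = 0 := by
  rw [inner_zbar_right, ← integral_noise_mul_proc.{u} c h i j]
  refine integral_congr_ae ?_
  filter_upwards [noiseLp_ae c t i] with ω h1
  rw [h1]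

theorem inner_noiseLp_of_mem_past {t : ℤ} (i : Fin k ⊕ Fin N) {v : Lp ℝ 2 (dgp.{u} c).P}
    (hv : v ∈ (dgp.{u} c).past (t - 1)) : inner ℝ (noiseLp.{u} c t i) v = 0 :=
  inner_eq_zero_of_mem_closedPast (fun _ _ j => inner_noiseLp_zbar c (by lia) i j) hv

/-- Any `K` between the span of the last observation and the whole past gives the same predictor.
This covers both projections in `exact_predictor`, for every lag order. -/
theorem starProjection_zbar_eq {K : Submodule ℝ (Lp ℝ 2 (dgp.{u} c).P)}
    [K.HasOrthogonalProjection] {t : ℤ} (hK : K ≤ (dgp.{u} c).past (t - 1))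
    (hmem : ∀ l, (dgp.{u} c).zbar (t - 1) l ∈ K) (i : Fin k ⊕ Fin N) :
    K.starProjection ((dgp.{u} c).zbar t i) =
      ∑ l, coeffMatrix c i l • (dgp.{u} c).zbar (t - 1) l := by
  refine Submodule.eq_starProjection_of_mem_orthogonal
    (Submodule.sum_mem _ fun l _ => Submodule.smul_mem _ _ (hmem l)) ?_
  rw [zbar_dgp_eq, add_sub_cancel_left, Submodule.mem_orthogonal']
  exact fun v hv => inner_noiseLp_of_mem_past c i (hK hv)

theorem innov_dgp (t : ℤ) (i : Fin k ⊕ Fin N) : (dgp.{u} c).innov t i = noiseLp c t i := by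
  rw [DGP.innov, starProjection_zbar_eq c le_rfl
    (fun l => mem_closedPast _ le_rfl l), sub_eq_iff_eq_add', ← zbar_dgp_eq]

theorem innovCov_dgp (t : ℤ) : (dgp.{u} c).innovCov t = 1 := by
  ext i j
  rw [DGP.innovCov_apply, innov_dgp, innov_dgp, inner_noiseLp, Matrix.one_apply]
  simp

theorem iIndepFun_innov :
    iIndepFun (fun (q : ℤ × (Fin k ⊕ Fin N)) ω => (dgp.{u} c).innov q.1 q.2 ω)
      (dgp.{u} c).P := by
  refine (iIndepFun_noise.{u} (ι := ℤ × (Fin k ⊕ Fin N))).congr fun q => ?_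
  rw [innov_dgp]
  exact (noiseLp_ae c q.1 q.2).symm

theorem alphaMix_dgp {n : ℕ} (hn : 0 < n) : (dgp.{u} c).alphaMix n = 0 :=
  DGP.alphaMix_eq_zero (iIndepFun_innov c) hn

theorem memLp_innov (t : ℤ) (p : ENNReal) :
    MemLp (fun ω => WithLp.toLp 2 (fun i => (dgp.{u} c).innov t i ω)) p (dgp.{u} c).P := by
  have hae : ∀ᵐ ω ∂(dgp.{u} c).P, ∀ i, |(dgp.{u} c).innov t i ω| = 1 := by
    refine ae_all_iff.2 fun i => ?_
    rw [innov_dgp]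
    filter_upwards [noiseLp_ae c t i] with ω h
    exact (congrArg abs h).trans (abs_noise _ _)
  -- The bound is the Euclidean norm of a vector of signs.
  refine MemLp.of_bound (Measurable.aestronglyMeasurable ?_) (√(∑ _i : Fin k ⊕ Fin N, (1 : ℝ)))
    ?_
  · exact (WithLp.measurable_toLp 2 _).comp (measurable_pi_lambda _ fun i => DGP.measurable_innov _ t i)
  · filter_upwards [hae] with ω h
    rw [EuclideanSpace.norm_eq]
    simp [h]

theorem finitePredictorExact_dgp {p : ℕ} (hp : 1 ≤ p) :
    (dgp.{u} c).FinitePredictorExact p where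
  one_le := hp
  stationary := fun t h i j => by
    rw [DGP.covariance_zc, DGP.covariance_zc]
    simp only [zc_dgp]
    have := integral_proc_mul_proc_add.{u} c t h 0 i j
    rw [zero_add, add_comm h t] at this
    exact this
  nondeterministic := by
    refine (Submodule.eq_bot_iff _).2 fun v hv => ?_
    rw [Submodule.mem_iInf] at hv
    -- A vector of the remote past lies in the past of `s - 1`, so it is orthogonal to the noise at
    -- each `s`, hence to the process, hence to itself.
    have h1 : ∀ s i, ∫ ω, v ω * noise (s, i) ω ∂(law k N) = 0 := fun s i => by
      rw [← inner_noiseLp_right, real_inner_comm]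
      exact inner_noiseLp_of_mem_past c i (hv _)
    have h2 : ∀ s ≤ 0, ∀ i, inner ℝ v ((dgp.{u} c).zbar s i) = 0 := fun s hs i => by
      rw [inner_zbar_right]
      exact integral_mul_proc_eq_zero c (Lp.memLp v) (fun s _ i => h1 s i) s hs i
    exact inner_self_eq_zero.1 (inner_eq_zero_of_mem_closedPast h2 (hv 0))
  exact_predictor := fun t i => by
    rw [starProjection_zbar_eq c le_rfl (fun l => mem_closedPast _ le_rfl l),
      starProjection_zbar_eq c (DGP.finitePast_le_past t) fun l => ?_]
    -- Index 0 stands for lag 1, which exists because `1 ≤ p`.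
    simpa using DGP.zbar_mem_finitePast (D := dgp.{u} c) t (⟨0, hp⟩ : Fin p) l
  mixing_moments := by
    refine ⟨1, one_pos, ?_, ?_, fun t => memLp_innov c t _⟩
    · refine tendsto_const_nhds.congr' ?_
      filter_upwards [eventually_gt_atTop 0] with n hn
      rw [alphaMix_dgp c hn]
    · simp only [alphaMix_dgp c (Nat.succ_pos _)]
      rw [Real.zero_rpow (by norm_num)]
      exact summable_zero
  posDef := fun t => by
    rw [innovCov_dgp]
    exact Matrix.PosDef.one

theorem isVAR_dgp : (dgp.{u} c).IsVAR 1 fun _ => coeffMatrix c := fun t i => by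
  rw [innov_dgp, zbar_dgp_eq]
  simp

theorem ebd_dgp {p : ℕ} (hp : 1 ≤ p) : (dgp.{u} c).EBD p := by
  refine (finitePredictorExact_dgp c hp).ebd_iff_sigmaXUZero.2 fun t => ?_
  rw [innovCov_dgp]
  ext i j
  exact Matrix.one_apply_ne (α := ℝ) (Sum.inl_ne_inr (a := i) (b := j))

theorem mem_classEBD {p : ℕ} (hp : 1 ≤ p) : dgp.{u} c ∈ DGP.classEBD.{u} k N p :=
  ⟨finitePredictorExact_dgp c hp, ebd_dgp c hp⟩

theorem uProc_eq_noise (hru : c.ru = 0) (t : ℤ) (i : Fin N) (ω : Sample.{u} k N) :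
    uProc c t i ω = noise (t, Sum.inr i) ω := by
  rw [uProc_eq, hru, Pi.zero_apply, zero_mul, zero_add]

theorem integral_noise_mul_proc_self_inl (t : ℤ) (i : Fin N) (j : Fin k) :
    ∫ ω, noise (t, Sum.inr i) ω * proc.{u} c t (Sum.inl j) ω ∂(law k N) = 0 := by
  rw [integral_mul_proc_inl c (memLp_noise _ 2), integral_noise_mul_noise]
  simp [integral_noise_mul_proc c (sub_one_lt t)]

/-- With `ru = 0` the disturbance is the current noise, which reaches the regressors only one period
later. -/
theorem presentPastExogenous_dgp (hru : c.ru = 0) : (dgp.{u} c).PresentPastExogenous := by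
  intro t s hs i j
  change ∫ ω, uProc c t i ω * proc c s (Sum.inl j) ω ∂(law k N) = 0
  simp only [uProc_eq_noise c hru]
  rcases hs.lt_or_eq with h | rfl
  · exact integral_noise_mul_proc c h _ _
  · exact integral_noise_mul_proc_self_inl c s i j

/-- The disturbance at time 0 has covariance `A j i` with the regressor at time 1. -/
theorem not_strictlyExogenous_dgp (hru : c.ru = 0) {i : Fin N} {j : Fin k} (hA : c.A j i ≠ 0) :
    ¬(dgp.{u} c).StrictlyExogenous := by
  intro h
  have h1 : ∫ ω, uProc.{u} c 0 i ω * proc c 1 (Sum.inl j) ω ∂(law k N) = 0 := h 0 1 i j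
  simp only [uProc_eq_noise c hru] at h1
  rw [integral_mul_proc_inl c (memLp_noise _ 2), sub_self, integral_noise_mul_proc_self_inl] at h1
  simp [proc, uProc_eq_noise c hru, integral_noise_mul_noise, hA] at h1

theorem integral_fun_mul_comm {Ω : Type*} {m : MeasurableSpace Ω} {P : Measure Ω} (f g : Ω → ℝ) :
    ∫ ω, f ω * g ω ∂P = ∫ ω, g ω * f ω ∂P := by
  simp only [mul_comm]

/-- If the contemporaneous covariances at times -1 and 0 both vanished, expanding the one at time 0
by the recursions would leave `A j i * ru i * Var(u_{-1,i}) = 0`. The condition `hA'` removes the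
contributions of the other disturbances. -/
theorem not_presentPastExogenous_dgp {i : Fin N} {j : Fin k} (hru : c.ru i ≠ 0)
    (hA : c.A j i ≠ 0) (hA' : ∀ l ≠ i, c.A j l = 0) : ¬(dgp.{u} c).PresentPastExogenous := by
  intro h
  have hx : ∀ t, ∫ ω, proc.{u} c t (Sum.inr i) ω * proc c t (Sum.inl j) ω ∂(law k N) = 0 :=
    fun t => h t t le_rfl i j
  have hmul : ∀ l, ∫ ω, proc.{u} c 0 (Sum.inr i) ω * proc c (-1) l ω ∂(law k N) =
      c.ru i * ∫ ω, proc.{u} c (-1) (Sum.inr i) ω * proc c (-1) l ω ∂(law k N) := by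
    intro l
    have h0 := integral_noise_mul_proc.{u} c (sub_one_lt 0) (Sum.inr i) l
    rw [integral_fun_mul_comm] at h0
    rw [integral_fun_mul_comm, integral_mul_proc_inr c (memLp_proc c _ _ 2), ← zero_sub (1 : ℤ),
      h0, add_zero, integral_fun_mul_comm]
  have hself : ∀ t, ∫ ω, proc.{u} c t (Sum.inr i) ω * noise (t, Sum.inr i) ω ∂(law k N) = 1 := by
    intro t
    rw [integral_fun_mul_comm, integral_mul_proc_inr c (memLp_noise _ 2),
      integral_noise_mul_proc c (sub_one_lt t), integral_noise_mul_noise]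
    simp
  have hcross : ∫ ω, proc.{u} c 0 (Sum.inr i) ω * noise (0, Sum.inl j) ω ∂(law k N) = 0 := by
    rw [integral_fun_mul_comm, integral_mul_proc_inr c (memLp_noise _ 2),
      integral_noise_mul_proc c (sub_one_lt 0), integral_noise_mul_noise]
    simp
  -- Zero variance would make the disturbance vanish almost surely, although its covariance with its
  -- own noise is 1.
  have hvar : ∫ ω, proc.{u} c (-1) (Sum.inr i) ω * proc c (-1) (Sum.inr i) ω ∂(law k N) ≠ 0 := by
    intro hzero
    have hae := (integral_eq_zero_iff_of_nonneg (fun ω => mul_self_nonneg _)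
      ((memLp_proc.{u} c (-1) (Sum.inr i) 2).integrable_mul (memLp_proc c (-1) (Sum.inr i) 2))).1
      hzero
    have h0 := hself (-1)
    rw [integral_congr_ae (g := fun _ => (0 : ℝ))] at h0
    · simp at h0
    · filter_upwards [hae] with ω hω
      rw [mul_self_eq_zero.1 hω, zero_mul]
  have h0 := hx 0
  rw [integral_mul_proc_inl c (memLp_proc c _ _ 2), hcross, zero_sub, hmul, hx,
    Finset.sum_eq_single i (fun l _ hl => by rw [hA' l hl, zero_mul]) (by simp), hmul] at h0
  simp [hru, hA, hvar] at h0

end TriangularVAR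

/-! ### Assembly and choice of the separating examples. -/

open TriangularVAR in
theorem proposition2 (k N p : ℕ) (hk : 1 ≤ k) (hN : 1 ≤ N) (hp : 1 ≤ p) :
    -- (i) strict exogeneity and BD are equivalent
    (∀ D : DGP.{u} k N, D.FinitePredictorExact p → (D.StrictlyExogenous ↔ D.BD p)) ∧
    -- (ii) pre-determinedness, EBD and the restriction on the innovation covariance coincide
    (∀ D : DGP.{u} k N, D.FinitePredictorExact p →
      (D.PreDetermined ↔ D.EBD p) ∧ (D.EBD p ↔ D.SigmaXUZero)) ∧
    -- (iii) strict nesting of the classes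
    (DGP.classBD.{u} k N p ⊂ DGP.classPP.{u} k N p ∩ DGP.classEBD.{u} k N p ∧
      DGP.classPP.{u} k N p ∩ DGP.classEBD.{u} k N p ⊂ DGP.classEBD.{u} k N p) ∧
    -- scalar VAR(1) processes that separate the classes
    (∀ γ : ℝ, γ ≠ 0 →
      ∃ D : DGP.{u} 1 1, D ∈ DGP.classPP.{u} 1 1 1 ∩ DGP.classEBD.{u} 1 1 1 ∧
        D ∉ DGP.classBD.{u} 1 1 1 ∧
        D.IsVAR 1 (fun _ => Matrix.fromBlocks !![0] !![γ] !![0] !![0])) ∧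
    (∀ ρx ρu α : ℝ, |ρx| < 1 → |ρu| < 1 → ρu ≠ 0 → α ≠ 0 →
      ∃ D : DGP.{u} 1 1, D ∈ DGP.classEBD.{u} 1 1 1 ∧
        D ∉ DGP.classPP.{u} 1 1 1 ∩ DGP.classEBD.{u} 1 1 1 ∧
        D.IsVAR 1 (fun _ => Matrix.fromBlocks !![ρx] !![α] !![0] !![ρu])) := by
  refine ⟨fun D hD => hD.strictlyExogenous_iff_bd, fun D hD =>
    ⟨D.preDetermined_iff_sigmaXUZero.trans hD.ebd_iff_sigmaXUZero.symm, hD.ebd_iff_sigmaXUZero⟩,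
    ⟨?_, ?_⟩, fun γ hγ => ?_, fun ρx ρu α hx hu hu0 hα => ?_⟩
  · refine ⟨fun D hD => ⟨⟨hD.1, fun t s _ => hD.1.strictlyExogenous_of_bd hD.2 t s⟩,
      hD.1, hD.2.ebd⟩, fun hle => ?_⟩
    let c : Coeffs k N := ⟨0, 0, fun _ _ => 1, by simp, by simp⟩
    have hmem := hle ⟨⟨finitePredictorExact_dgp.{u} c hp, presentPastExogenous_dgp c rfl⟩,
      mem_classEBD c hp⟩
    exact not_strictlyExogenous_dgp c rfl (i := ⟨0, hN⟩) (j := ⟨0, hk⟩) one_ne_zero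
      (hmem.1.strictlyExogenous_of_bd hmem.2)
  · refine ⟨Set.inter_subset_right, fun hle => ?_⟩
    -- Only the first disturbance feeds the regressors, so the single-entry condition on the rows of
    -- `A` holds. Any nonzero coefficient in `(-1, 1)` could replace `1 / 2`.
    let c : Coeffs k N := ⟨0, fun _ => 1 / 2, fun _ l => if l = ⟨0, hN⟩ then 1 else 0, by simp,
      fun _ => by norm_num [abs_lt]⟩
    refine not_presentPastExogenous_dgp.{u} c (i := ⟨0, hN⟩) (j := ⟨0, hk⟩) ?_ ?_ ?_
      (hle (mem_classEBD c hp)).1.2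
    · norm_num [c]
    · simp [c]
    · intro l hl
      simp [c, hl]
  · let c : Coeffs 1 1 := ⟨0, 0, fun _ _ => γ, by simp, by simp⟩
    refine ⟨dgp c, ⟨⟨finitePredictorExact_dgp c le_rfl, presentPastExogenous_dgp c rfl⟩,
      mem_classEBD c le_rfl⟩, fun h => not_strictlyExogenous_dgp c rfl (i := 0) (j := 0) hγ
        (h.1.strictlyExogenous_of_bd h.2), ?_⟩
    convert isVAR_dgp c using 2
    rw [coeffMatrix]
    congr 1 <;> ext i j <;> simp [c, Subsingleton.elim i j]
  · let c : Coeffs 1 1 := ⟨fun _ => ρx, fun _ => ρu, fun _ _ => α, fun _ => hx, fun _ => hu⟩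
    refine ⟨dgp c, mem_classEBD c le_rfl, fun h => not_presentPastExogenous_dgp c (i := 0) (j := 0)
      hu0 hα (fun l hl => absurd (Subsingleton.elim l 0) hl) h.1.2, ?_⟩
    convert isVAR_dgp c using 2
    rw [coeffMatrix]
    congr 1 <;> ext i j <;> simp [c, Subsingleton.elim i j]
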